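/- Let $G=(S,S_s,S_e,I,A,T,W)$ be a turn-based stochastic Rabin game: $S$ and $A$ are finite; $S_s\subseteq S$ are the system states and $S_e=S\setminus S_s$ the environment states; $I\subseteq S$ are the initial states; each state $s$ has a nonempty set $A^G(s)\subseteq A$ of available actions; $T:S\times A\to\mathcal D(S)$ gives the transition probabilities; and $W=\{(E_i,F_i)\}_{i=1}^{d}$ is a set of Rabin pairs, $E_i,F_i\subseteq S$, $E_i\cap F_i=\emptyset$. A run is winning for the system if, for some $i$, it visits some state of $F_i$ infinitely often and every state of $E_i$ only finitely often. Let $\mathcal R:S\times A\times S\to\mathbb R^{\ge 0}$ be a reward function and $\gamma\in(0,1)$ a discount factor. A strategy of a player has a countable set of memory states, an initial memory state, a memory update that depends on the current state and memory, and assigns to each state of that player and each memory state a probability distribution on the available actions; it is memoryless if it has only one memory state. Let $\Sigma_s$ and $\Sigma_e$ be the sets of all strategies of the system and of the environment. A system strategy is almost-sure winning if, for every environment strategy and every initial state in $I$, the run is winning with probability $1$. Write $V(s,\sigma_s,\sigma_e)$ for the expected value, from the state $s$, of the discounted reward $\sum_{t\ge 0}\gamma^t\mathcal R(s_t,a_{t+1},s_{t+1})$,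 and put $\tilde V(s,\sigma_s)=\inf_{\sigma_e\in\Sigma_e}V(s,\sigma_s,\sigma_e)$ and $V^*(s)=\sup_{\sigma_s\in\Sigma_s}\tilde V(s,\sigma_s)$. A system strategy $\sigma_s$ is $\varepsilon$-optimal if $\tilde V(s,\sigma_s)\ge V^*(s)-\varepsilon$ for all $s\in S$. For $s\in S_s$ the set of optimal actions is $$A^*(s)=\arg\max_{a\in A^G(s)}\sum_{s'\in S}T(s,a)(s')\bigl(\mathcal R(s,a,s')+\gamma V^*(s')\bigr),$$ and for a memoryless system strategy $\sigma$ let $A_\sigma(s)=\{a\in A^G(s):\sigma(s)(a)>0\}$. Theorem. Suppose that $\sigma$ is a memoryless almost-sure winning system strategy with $A_\sigma(s)\cap A^*(s)\neq\emptyset$ for every $s\in S_s$. Then for every $\varepsilon>0$ there is a memoryless system strategy $\sigma'$ with $A_{\sigma'}(s)=A_\sigma(s)$ for all $s\in S_s$ that is both almost-sure winning and $\varepsilon$-optimal. -/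

import Mathlib

open MeasureTheory ProbabilityTheory Filter
open scoped NNReal

noncomputable section

/-- A turn-based stochastic Rabin game on the state space `S` with actions `A`
(both are finite in the theorem). The states outside `sys` belong to the environment. -/
structure RabinGame (S A : Type*) where
  /-- the states at which the system chooses the action -/
  sys : Set S
  /-- the initial states -/
  init : Set S
  /-- the actions that are available at a state -/
  avail : S → Set A
  avail_nonempty : ∀ s, (avail s).Nonempty
  /-- the transition function -/
  trans : S → A → PMF S
  /-- the Rabin pairs `(E, F)` -/
  pairs : Set (Set S × Set S)
  pairs_disjoint : ∀ p ∈ pairs, Disjoint p.1 p.2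

/-- One entry of a run: a state together with the action taken there. -/
structure Entry (S A : Type*) where
  state : S
  action : A

instance {S A : Type*} : MeasurableSpace (Entry S A) := ⊤

/-- Infinite sequences of state-action pairs, with the product `σ`-algebra (that is, the one
generated by the cylinder sets). -/
abbrev Run (S A : Type*) := ℕ → Entry S A

namespace Run

variable {S A : Type*}

/-- The set of states that are visited infinitely often. -/
def infStates (π : Run S A) : Set S := {s | ∃ᶠ n in atTop, (π n).state = s}

/-- The discounted reward of a run. -/
def discountedReward (R : S → A → S → ℝ≥0) (γ : ℝ) (π : Run S A) : ℝ :=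
  ∑' t : ℕ, γ ^ t * (R (π t).state (π t).action (π (t + 1)).state : ℝ)

end Run

namespace RabinGame

variable {S A : Type*} (G : RabinGame S A)

/-- A randomized strategy, with countable memory, of the player who owns the states in `P`. -/
structure Strategy (P : Set S) where
  /-- the memory states -/
  Mem : Type
  countable_mem : Countable Mem
  /-- the initial memory state -/
  init : Mem
  /-- the distribution of the next action -/
  act : P → Mem → PMF A
  /-- the memory update -/
  update : S → Mem → Mem
  /-- only available actions are taken -/
  act_avail : ∀ s m, (act s m).support ⊆ G.avail s

/-- Strategies of the system. -/
abbrev SysStrategy := G.Strategy G.sys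

/-- Strategies of the environment. -/
abbrev EnvStrategy := G.Strategy G.sysᶜ

variable {G}

/-- A strategy is memoryless if its set of memory states is a singleton. -/
def Strategy.IsMemoryless {P : Set S} (σ : G.Strategy P) : Prop :=
  ∃ m : σ.Mem, ∀ m' : σ.Mem, m' = m

/-- The set of actions that a strategy allows at a state with a given memory. -/
def Strategy.allowed {P : Set S} (σ : G.Strategy P) (s : P) (m : σ.Mem) : Set A :=
  {a | 0 < σ.act s m a ∧ a ∈ G.avail s}

/-- A configuration of a play: the current state and action, and the memory states of the two
players at that moment (those with which the action is chosen). -/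
structure Config (σ : G.SysStrategy) (τ : G.EnvStrategy) where
  entry : Entry S A
  sysMem : σ.Mem
  envMem : τ.Mem

instance (σ : G.SysStrategy) (τ : G.EnvStrategy) : MeasurableSpace (Config σ τ) := ⊤

open Classical in
/-- The distribution of the action that is taken at the state `s`, by the player who owns `s`. -/
def actionDist (σ : G.SysStrategy) (τ : G.EnvStrategy) (s : S) (m : σ.Mem) (n : τ.Mem) : PMF A :=
  if h : s ∈ G.sys then σ.act ⟨s, h⟩ m else τ.act ⟨s, h⟩ n

/-- The configuration at a given state with given memories, with its random action. -/
def configAt (σ : G.SysStrategy) (τ : G.EnvStrategy) (s : S) (m : σ.Mem) (n : τ.Mem) :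
    PMF (Config σ τ) :=
  (actionDist σ τ s m n).map fun a => ⟨⟨s, a⟩, m, n⟩

/-- One step of a play: the next state is drawn from the transition function, both players update
their memories with the state that is left, and the next action is drawn. -/
def stepDist (σ : G.SysStrategy) (τ : G.EnvStrategy) (c : Config σ τ) : PMF (Config σ τ) :=
  (G.trans c.entry.state c.entry.action).bind fun s' =>
    configAt σ τ s' (σ.update c.entry.state c.sysMem) (τ.update c.entry.state c.envMem)

/-- One step of a play as a Markov kernel. -/
def stepKernel (σ : G.SysStrategy) (τ : G.EnvStrategy) : Kernel (Config σ τ) (Config σ τ) where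
  toFun c := (stepDist σ τ c).toMeasure
  measurable' := measurable_from_top

instance (σ : G.SysStrategy) (τ : G.EnvStrategy) : IsMarkovKernel (stepKernel σ τ) :=
  ⟨fun c => inferInstanceAs (IsProbabilityMeasure (stepDist σ τ c).toMeasure)⟩

/-- The step kernel, applied to the last configuration of a finite history. -/
def historyKernel (σ : G.SysStrategy) (τ : G.EnvStrategy) (n : ℕ) :
    Kernel ((_ : Finset.Iic n) → Config σ τ) (Config σ τ) :=
  (stepKernel σ τ).comap (fun h => h ⟨n, Finset.mem_Iic.2 le_rfl⟩) (measurable_pi_apply _)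

instance (σ : G.SysStrategy) (τ : G.EnvStrategy) (n : ℕ) :
    IsMarkovKernel (historyKernel σ τ n) := by
  unfold historyKernel; infer_instance

/-- The law of the sequence of configurations of the play from the state `s₀`. -/
def configLaw (σ : G.SysStrategy) (τ : G.EnvStrategy) (s₀ : S) : Measure (ℕ → Config σ τ) :=
  ((configAt σ τ s₀ σ.init τ.init).toMeasure.map fun c (_ : Finset.Iic 0) => c).bind
    (Kernel.traj (X := fun _ => Config σ τ) (historyKernel σ τ) 0)

/-- The law of the run that starts at `s₀` when the players use the strategies `σ` and `τ`. -/
def runLaw (σ : G.SysStrategy) (τ : G.EnvStrategy) (s₀ : S) : Measure (Run S A) :=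
  (configLaw σ τ s₀).map fun c n => (c n).entry

variable (G)

/-- The runs that satisfy the Rabin condition. -/
def winningRuns : Set (Run S A) :=
  {π | ∃ p ∈ G.pairs, (π.infStates ∩ p.2).Nonempty ∧ π.infStates ∩ p.1 = ∅}

variable {G}

/-- Against every environment strategy and from every initial state, the run satisfies the Rabin
condition with probability one. -/
def AlmostSureWinning (σ : G.SysStrategy) : Prop :=
  ∀ τ : G.EnvStrategy, ∀ s ∈ G.init, ∀ᵐ π ∂(runLaw σ τ s), π ∈ G.winningRuns

/-- The expected discounted reward from the state `s`. -/
def value (R : S → A → S → ℝ≥0) (γ : ℝ) (s : S) (σ : G.SysStrategy) (τ : G.EnvStrategy) : ℝ :=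
  ∫ π, π.discountedReward R γ ∂(runLaw σ τ s)

/-- The value of a system strategy: its worst case over all environment strategies. -/
def strategyValue (R : S → A → S → ℝ≥0) (γ : ℝ) (s : S) (σ : G.SysStrategy) : ℝ :=
  ⨅ τ : G.EnvStrategy, value R γ s σ τ

variable (G)

/-- The optimal value of a state, over all system strategies. -/
def optimalValue (R : S → A → S → ℝ≥0) (γ : ℝ) (s : S) : ℝ :=
  ⨆ σ : G.SysStrategy, strategyValue R γ s σ

/-- The expected reward of taking the action `a` at `s` and collecting the optimal value of the
next state, discounted. -/
def actionValue [Fintype S] (R : S → A → S → ℝ≥0) (γ : ℝ) (s : S) (a : A) : ℝ :=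
  ∑ s' : S, (G.trans s a s').toReal * ((R s a s' : ℝ) + γ * G.optimalValue R γ s')

/-- The set of optimal actions at a state. -/
def optimalActions [Fintype S] (R : S → A → S → ℝ≥0) (γ : ℝ) (s : S) : Set A :=
  {a | a ∈ G.avail s ∧ ∀ b ∈ G.avail s, G.actionValue R γ s b ≤ G.actionValue R γ s a}

variable {G}

/-- A system strategy is `ε`-optimal if at every state it guarantees the optimal value up to `ε`. -/
def EpsOptimal (R : S → A → S → ℝ≥0) (γ ε : ℝ) (σ : G.SysStrategy) : Prop :=
  ∀ s : S, G.optimalValue R γ s - ε ≤ strategyValue R γ s σ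

end RabinGame

end

/-! For a memoryless system strategy, almost-sure winning depends only on which actions have
positive probability, whereas the discounted value varies with the probabilities themselves. At each
system state, put weight `1 - d` on an optimal action that `σ` allows and weight `d` on `σ`. The
supports do not change, and for small `d` the value is almost optimal.

Winning. Against any environment strategy almost every run is fair (`ae_isFairRun`), and fairness
mentions only the supports. So it suffices that an almost-sure winning `σ` wins every fair run `π`
from an initial state (`AlmostSureWinning.winning_of_fair`). For this, a memoryless environment
imitates `π`: with positive probability the play reaches the set of states that `π` visits
infinitely often, and from then on almost surely visits exactly that set infinitely often. Since the
play wins almost surely, `π` wins.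

Value. For any `u`, the value minus `u` at the start is the discounted sum of the expected
advantages with respect to `u` (`hasSum_advantage`). With `u` the solution `v` of Shapley's
equations, this identifies `v` as the optimal value. It also bounds the loss of the mixture: optimal
actions have advantage zero, so with advantages bounded by `|K|` each step costs at most `d * |K|`,
in total at most `d * |K| / (1 - γ)`. -/

/-! ### Finite distributions and mixtures -/

lemma PMF.sum_bind_toReal_mul {α β : Type*} [Fintype α] [Fintype β] (p : PMF α) (k : α → PMF β)
    (f : β → ℝ) :
    ∑ b, (p.bind k b).toReal * f b = ∑ a, (p a).toReal * ∑ b, (k a b).toReal * f b := by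
  have h : ∀ b, (p.bind k b).toReal = ∑ a, (p a).toReal * (k a b).toReal := by
    intro b
    rw [PMF.bind_apply, tsum_fintype, ENNReal.toReal_sum fun a _ =>
      ENNReal.mul_ne_top (PMF.apply_ne_top _ _) (PMF.apply_ne_top _ _)]
    simp only [ENNReal.toReal_mul]
  simp only [h, Finset.sum_mul, Finset.mul_sum]
  rw [Finset.sum_comm]
  simp only [mul_assoc]

lemma PMF.sum_map_toReal_mul {α β : Type*} [Fintype α] [Fintype β] (p : PMF α) (h : α → β)
    (f : β → ℝ) :
    ∑ b, (p.map h b).toReal * f b = ∑ a, (p a).toReal * f (h a) := by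
  classical
  have hp : ∀ a, ∑ b, (PMF.pure (h a) b).toReal * f b = f (h a) := by
    intro a
    rw [Finset.sum_eq_single (h a)]
    · simp
    · intro b _ hb
      simp [hb]
    · simp
  rw [← PMF.bind_pure_comp, PMF.sum_bind_toReal_mul]
  simp only [Function.comp_apply, hp]

lemma PMF.sum_toReal {α : Type*} [Fintype α] (p : PMF α) : ∑ a, (p a).toReal = 1 := by
  rw [← ENNReal.toReal_sum fun a _ => PMF.apply_ne_top _ _,
    ← tsum_fintype (L := .unconditional α), p.tsum_coe,
    ENNReal.toReal_one]

/-- The mixture of two distributions with weights `1 - d` and `d`. -/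
noncomputable def PMF.mix {α : Type*} (p q : PMF α) (d : ℝ) (h₀ : 0 < d) (h₁ : d < 1) : PMF α :=
  ⟨fun a => ENNReal.ofReal (1 - d) * p a + ENNReal.ofReal d * q a, by
    rw [ENNReal.summable.hasSum_iff, ENNReal.tsum_add, ENNReal.tsum_mul_left,
      ENNReal.tsum_mul_left, p.tsum_coe, q.tsum_coe, mul_one, mul_one,
      ← ENNReal.ofReal_add (by linarith) h₀.le]
    simp⟩

lemma PMF.mix_apply {α : Type*} (p q : PMF α) {d : ℝ} (h₀ : 0 < d) (h₁ : d < 1) (a : α) :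
    p.mix q d h₀ h₁ a = ENNReal.ofReal (1 - d) * p a + ENNReal.ofReal d * q a := rfl

lemma PMF.mix_toReal {α : Type*} (p q : PMF α) {d : ℝ} (h₀ : 0 < d) (h₁ : d < 1) (a : α) :
    (p.mix q d h₀ h₁ a).toReal = (1 - d) * (p a).toReal + d * (q a).toReal := by
  rw [PMF.mix_apply, ENNReal.toReal_add
    (ENNReal.mul_ne_top ENNReal.ofReal_ne_top (PMF.apply_ne_top _ _))
    (ENNReal.mul_ne_top ENNReal.ofReal_ne_top (PMF.apply_ne_top _ _)), ENNReal.toReal_mul,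
    ENNReal.toReal_mul, ENNReal.toReal_ofReal (by linarith), ENNReal.toReal_ofReal h₀.le]

lemma PMF.support_mix {α : Type*} (p q : PMF α) {d : ℝ} (h₀ : 0 < d) (h₁ : d < 1) :
    (p.mix q d h₀ h₁).support = p.support ∪ q.support := by
  ext a
  have h1 : ENNReal.ofReal (1 - d) ≠ 0 := by simpa using h₁
  have h2 : ENNReal.ofReal d ≠ 0 := by simpa using h₀
  simp only [PMF.mem_support_iff, PMF.mix_apply, Set.mem_union, ne_eq, add_eq_zero, mul_eq_zero,
    h1, h2, false_or]
  tauto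

namespace RabinGame

variable {S A : Type*} {G : RabinGame S A}

/-! ### The play as a Markov chain of configurations -/

instance countable_config [Countable S] [Countable A] (σ : G.SysStrategy) (τ : G.EnvStrategy) :
    Countable (Config σ τ) := by
  have := σ.countable_mem
  have := τ.countable_mem
  have hinj : Function.Injective
      fun c : Config σ τ => (c.entry.state, c.entry.action, c.sysMem, c.envMem) := by
    rintro ⟨⟨s, a⟩, m, n⟩ ⟨⟨s', a'⟩, m', n'⟩ h
    simpa [and_assoc] using h
  exact hinj.countable

instance discrete_config (σ : G.SysStrategy) (τ : G.EnvStrategy) :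
    DiscreteMeasurableSpace (Config σ τ) := ⟨fun _ => trivial⟩

instance discrete_entry : DiscreteMeasurableSpace (Entry S A) := ⟨fun _ => trivial⟩

lemma measurable_const_history {X : Type*} [MeasurableSpace X] :
    Measurable fun (c : X) (_ : Finset.Iic 0) => c :=
  measurable_pi_lambda _ fun _ => measurable_id

section Law

variable (σ : G.SysStrategy) (τ : G.EnvStrategy) (s₀ : S)

instance isProbabilityMeasure_configLaw : IsProbabilityMeasure (configLaw σ τ s₀) := by
  unfold configLaw
  have : IsProbabilityMeasure
      ((configAt σ τ s₀ σ.init τ.init).toMeasure.map fun c (_ : Finset.Iic 0) => c) :=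
    Measure.isProbabilityMeasure_map measurable_const_history.aemeasurable
  infer_instance

lemma measurable_entries :
    Measurable fun (c : ℕ → Config σ τ) (n : ℕ) => (c n).entry :=
  measurable_pi_lambda _ fun n => measurable_from_top.comp (measurable_pi_apply n)

lemma configLaw_map_zero :
    (configLaw σ τ s₀).map (fun c => c 0) = (configAt σ τ s₀ σ.init τ.init).toMeasure := by
  unfold configLaw
  have h : (fun c : ℕ → Config σ τ => c 0) =
      (fun x : Finset.Iic 0 → Config σ τ => x ⟨0, by simp⟩) ∘ Preorder.frestrictLe 0 := rfl
  rw [Measure.map_comp _ _ (measurable_pi_apply 0), h,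
    Kernel.map_comp_right _ (Preorder.measurable_frestrictLe 0) (by fun_prop),
    Kernel.traj_map_frestrictLe, Kernel.partialTraj_self, Kernel.id_map (by fun_prop),
    Measure.deterministic_comp_eq_map,
    Measure.map_map (by fun_prop) measurable_const_history]
  exact Measure.map_id

/-- The Markov property: `historyKernel` reads only the last coordinate of the history, so the law
of two consecutive configurations is determined by the law of the first. -/
lemma traj_map_pair (n : ℕ) :
    (Kernel.traj (X := fun _ => Config σ τ) (historyKernel σ τ) 0).map
      (fun c => (c n, c (n + 1))) =
    (Kernel.id ×ₖ stepKernel σ τ) ∘ₖ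
      (Kernel.traj (X := fun _ => Config σ τ) (historyKernel σ τ) 0).map (fun c => c n) := by
  ext1 x
  rw [Kernel.map_apply _ (by fun_prop), Kernel.comp_apply, Kernel.map_apply _ (by fun_prop),
    ← Measure.compProd_eq_comp_prod]
  have h1 : (fun c : ℕ → Config σ τ => (c n, c (n + 1))) =
      (Prod.map (fun h : Finset.Iic n → Config σ τ => h ⟨n, by simp⟩) id) ∘
        (fun c => (Preorder.frestrictLe (π := fun _ => Config σ τ) n c, c (n + 1))) := rfl
  have h2 : (fun c : ℕ → Config σ τ => c n) =
      (fun h : Finset.Iic n → Config σ τ => h ⟨n, by simp⟩) ∘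
        Preorder.frestrictLe (π := fun _ => Config σ τ) n := rfl
  rw [h1, ← Measure.map_map (by fun_prop) (by fun_prop),
    ← Kernel.partialTraj_compProd_eq_map_traj (Nat.zero_le n), h2,
    ← Measure.map_map (by fun_prop) (by fun_prop), Kernel.traj_map_frestrictLe_apply]
  ext s hs
  rw [Measure.map_apply (by fun_prop) hs, Measure.compProd_apply (by measurability),
    Measure.compProd_apply hs, lintegral_map
    (Kernel.measurable_kernel_prodMk_left hs) (by fun_prop)]
  rfl

lemma configLaw_map_pair (n : ℕ) :
    (configLaw σ τ s₀).map (fun c => (c n, c (n + 1))) =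
      (configLaw σ τ s₀).map (fun c => c n) ⊗ₘ stepKernel σ τ := by
  rw [Measure.compProd_eq_comp_prod]
  unfold configLaw
  rw [Measure.map_comp _ _ (by fun_prop), traj_map_pair, Measure.map_comp _ _ (by fun_prop),
    Measure.comp_assoc]

lemma ae_mem_support_configAt :
    ∀ᵐ c ∂(configLaw σ τ s₀), c 0 ∈ (configAt σ τ s₀ σ.init τ.init).support := by
  have h : ∀ᵐ x ∂((configLaw σ τ s₀).map (fun c => c 0)),
      x ∈ (configAt σ τ s₀ σ.init τ.init).support := by
    rw [configLaw_map_zero, ae_iff, PMF.toMeasure_apply_eq_zero_iff _ (by measurability)]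
    exact Set.disjoint_left.2 fun x hx hx' => hx' hx
  exact ae_of_ae_map (measurable_pi_apply 0).aemeasurable h

lemma ae_mem_support_stepDist [Countable S] [Countable A] :
    ∀ᵐ c ∂(configLaw σ τ s₀), ∀ n, c (n + 1) ∈ (stepDist σ τ (c n)).support := by
  refine ae_all_iff.2 fun n => ?_
  have h : ∀ᵐ x ∂((configLaw σ τ s₀).map (fun c => (c n, c (n + 1)))),
      x.2 ∈ (stepDist σ τ x.1).support := by
    rw [configLaw_map_pair, Measure.ae_compProd_iff (by measurability)]
    refine ae_of_all _ fun x => ?_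
    change ∀ᵐ y ∂(stepDist σ τ x).toMeasure, _
    rw [ae_iff, PMF.toMeasure_apply_eq_zero_iff _ (by measurability)]
    exact Set.disjoint_left.2 fun x hx hx' => hx' hx
  exact ae_of_ae_map (by fun_prop) h

lemma configLaw_eval_zero_pos {c₀ : Config σ τ}
    (h : c₀ ∈ (configAt σ τ s₀ σ.init τ.init).support) :
    0 < configLaw σ τ s₀ {c | c 0 = c₀} := by
  have h' : configLaw σ τ s₀ {c | c 0 = c₀} = (configLaw σ τ s₀).map (fun c => c 0) {c₀} := by
    rw [Measure.map_apply (by fun_prop) (by measurability)]; rfl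
  rw [h', configLaw_map_zero, PMF.toMeasure_apply_singleton _ _ (by measurability)]
  exact pos_iff_ne_zero.2 h

/-- Iterated, this lets the play reach with positive probability the end of any finite path of
possible steps. -/
lemma configLaw_eval_succ_pos [Countable S] [Countable A] {n : ℕ} {x y : Config σ τ}
    (hx : 0 < configLaw σ τ s₀ {c | c n = x}) (hy : y ∈ (stepDist σ τ x).support) :
    0 < configLaw σ τ s₀ {c | c (n + 1) = y} := by
  have h1 : configLaw σ τ s₀ {c | c n = x} = (configLaw σ τ s₀).map (fun c => c n) {x} := by
    rw [Measure.map_apply (by fun_prop) (by measurability)]; rfl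
  have h2 : (configLaw σ τ s₀).map (fun c => (c n, c (n + 1))) {(x, y)} ≤
      configLaw σ τ s₀ {c | c (n + 1) = y} := by
    rw [Measure.map_apply (by fun_prop) (by measurability)]
    exact measure_mono fun c hc => (Prod.ext_iff.1 hc).2
  refine lt_of_lt_of_le ?_ h2
  rw [configLaw_map_pair, ← Set.singleton_prod_singleton, Measure.compProd_apply_prod
    (by measurability) (by measurability), Measure.restrict_singleton, lintegral_smul_measure,
    lintegral_dirac, ← h1]
  refine ENNReal.mul_pos hx.ne' ?_
  change (stepDist σ τ x).toMeasure {y} ≠ 0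
  rw [PMF.toMeasure_apply_singleton _ _ (by measurability)]
  exact hy

/-! ### Recurrence by the conditional Borel–Cantelli lemma -/

lemma measurableSet_frequently {X : Type*} [MeasurableSpace X] {B : ℕ → Set X}
    (hB : ∀ n, MeasurableSet (B n)) : MeasurableSet {x | ∃ᶠ n in atTop, x ∈ B n} := by
  have h : {x | ∃ᶠ n in atTop, x ∈ B n} = ⋂ N, ⋃ n, ⋃ (_ : N ≤ n), B n := by
    ext x; simp [frequently_atTop]
  rw [h]
  exact MeasurableSet.iInter fun N => MeasurableSet.iUnion fun n =>
    MeasurableSet.iUnion fun _ => hB n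

lemma tendsto_sum_atTop_of_frequently_le {f : ℕ → ℝ} (hf : ∀ n, 0 ≤ f n) {p : ℝ} (hp : 0 < p)
    (h : ∃ᶠ n in atTop, p ≤ f n) :
    Tendsto (fun n => ∑ k ∈ Finset.range n, f k) atTop atTop := by
  have hmono : Monotone fun n => ∑ k ∈ Finset.range n, f k :=
    fun a b hab => Finset.sum_le_sum_of_subset_of_nonneg (by simpa using hab) fun i _ _ => hf i
  refine hmono.tendsto_atTop_atTop fun b => ?_
  have key : ∀ k : ℕ, ∃ n, k * p ≤ ∑ k ∈ Finset.range n, f k := by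
    intro k
    induction k with
    | zero => exact ⟨0, by simp⟩
    | succ k ih =>
      obtain ⟨n, hn⟩ := ih
      obtain ⟨m, hm, hmB⟩ := frequently_atTop.1 h n
      refine ⟨m + 1, ?_⟩
      rw [Finset.sum_range_succ]
      have := hmono hm
      push_cast
      simp only at *
      linarith
  obtain ⟨k, hk⟩ := exists_nat_ge (b / p)
  obtain ⟨n, hn⟩ := key k
  exact ⟨n, ((div_le_iff₀ hp).1 hk).trans hn⟩

lemma measurableSet_piLE_eval_mem (C : Set (Config σ τ)) (n : ℕ) :
    MeasurableSet[Filtration.piLE (X := fun _ => Config σ τ) n]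
      {c : ℕ → Config σ τ | c n ∈ C} := by
  have : {c : ℕ → Config σ τ | c n ∈ C} = Preorder.frestrictLe (π := fun _ => Config σ τ) n ⁻¹'
      {h | h ⟨n, by simp⟩ ∈ C} := rfl
  rw [this, Filtration.piLE_eq_comap_frestrictLe]
  exact ⟨_, measurable_pi_apply _ (MeasurableSet.of_discrete (s := C)), rfl⟩

lemma measurableSet_eval_mem (C : Set (Config σ τ)) (n : ℕ) :
    MeasurableSet {c : ℕ → Config σ τ | c n ∈ C} :=
  measurable_pi_apply n (MeasurableSet.of_discrete (s := C))

lemma traj_eval_succ {X : ℕ → Type*} [∀ n, MeasurableSpace (X n)]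
    (κ : (n : ℕ) → Kernel ((i : Finset.Iic n) → X i) (X (n + 1))) [∀ n, IsMarkovKernel (κ n)]
    (n : ℕ) (x : (i : Finset.Iic n) → X i) {C : Set (X (n + 1))} (hC : MeasurableSet C) :
    Kernel.traj κ n x ((fun c => c (n + 1)) ⁻¹' C) = κ n x C := by
  rw [← Measure.map_apply (by fun_prop) hC, ← Kernel.map_apply _ (by fun_prop),
    Kernel.map_traj_succ_self]

lemma condExp_traj_succ {X : ℕ → Type*} [∀ n, MeasurableSpace (X n)]
    (κ : (n : ℕ) → Kernel ((i : Finset.Iic n) → X i) (X (n + 1))) [∀ n, IsMarkovKernel (κ n)]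
    (x₀ : (i : Finset.Iic 0) → X i) (n : ℕ) {C : Set (X (n + 1))} (hC : MeasurableSet C) :
    (Kernel.traj κ 0 x₀)[
        Set.indicator ((fun c => c (n + 1)) ⁻¹' C) (1 : ((n : ℕ) → X n) → ℝ) |
        Filtration.piLE (X := X) n]
      =ᵐ[Kernel.traj κ 0 x₀] fun c => (κ n (Preorder.frestrictLe n c)).real C := by
  have hmeas : Measurable fun c : (n : ℕ) → X n => c (n + 1) := measurable_pi_apply _
  refine (Kernel.condExp_traj (κ := κ) (Nat.zero_le n) (x₀ := x₀)
    ((integrable_const (1 : ℝ)).indicator (hmeas hC))).trans (ae_of_all _ fun c => ?_)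
  refine (integral_indicator_one (hmeas hC)).trans ?_
  simp only [measureReal_def]
  rw [traj_eval_succ κ n _ hC]

/-- Each visit to `B` adds at least `p` to the sum of the conditional probabilities of entering `C`
at the next step. Infinitely many visits make the sum diverge, and Lévy's conditional Borel–Cantelli
lemma applies. -/
lemma ae_frequently_of_le_stepDist (B C : Set (Config σ τ))
    {p : ℝ} (hp : 0 < p) (hBC : ∀ x ∈ B, p ≤ (stepKernel σ τ x).real C) :
    ∀ᵐ c ∂(configLaw σ τ s₀), (∃ᶠ n in atTop, c n ∈ B) → ∃ᶠ n in atTop, c (n + 1) ∈ C := by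
  suffices h : ∀ x₀, ∀ᵐ c ∂(Kernel.traj (X := fun _ => Config σ τ) (historyKernel σ τ) 0 x₀),
      (∃ᶠ n in atTop, c n ∈ B) → ∃ᶠ n in atTop, c (n + 1) ∈ C by
    unfold configLaw
    refine Measure.ae_comp_of_ae_ae ?_ (ae_of_all _ h)
    exact (measurableSet_frequently fun n => measurableSet_eval_mem σ τ B n).imp
      (measurableSet_frequently fun n => measurableSet_eval_mem σ τ C (n + 1))
  intro x₀
  filter_upwards [ae_mem_limsup_atTop_iff _ (measurableSet_piLE_eval_mem σ τ C),
    ae_all_iff.2 fun n => condExp_traj_succ (X := fun _ => Config σ τ)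
      (historyKernel σ τ) x₀ n (MeasurableSet.of_discrete (s := C))] with c h1 h2 hB
  have hlim : Tendsto (fun n => ∑ k ∈ Finset.range n, (stepKernel σ τ (c k)).real C)
      atTop atTop :=
    tendsto_sum_atTop_of_frequently_le (fun _ => measureReal_nonneg) hp
      (hB.mono fun n hn => hBC _ hn)
  have h3 := h1.2 (hlim.congr fun n => Finset.sum_congr rfl fun k _ => (h2 k).symm)
  rw [mem_limsup_iff_frequently_mem] at h3
  rw [frequently_atTop] at h3 ⊢
  intro N
  obtain ⟨m, hm, hmC⟩ := h3 (N + 1)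
  obtain ⟨k, rfl⟩ : ∃ k, m = k + 1 := ⟨m - 1, by omega⟩
  exact ⟨k, by omega, hmC⟩

end Law

/-! ### Fair runs -/

lemma frequently_exists_iff_of_finite {ι α : Type*} [Finite ι] {l : Filter α} {p : ι → α → Prop} :
    (∃ᶠ x in l, ∃ i, p i x) ↔ ∃ i, ∃ᶠ x in l, p i x := by
  simp only [Filter.Frequently, not_exists, eventually_all, not_forall]

instance finite_entry [Finite S] [Finite A] : Finite (Entry S A) := by
  have hinj : Function.Injective fun e : Entry S A => (e.state, e.action) := by
    rintro ⟨s, a⟩ ⟨s', a'⟩ h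
    simpa using h
  exact Finite.of_injective _ hinj

section Support

variable {σ : G.SysStrategy} {τ : G.EnvStrategy}

lemma configAt_apply (s : S) (m : σ.Mem) (n : τ.Mem) (a : A) :
    configAt σ τ s m n ⟨⟨s, a⟩, m, n⟩ = actionDist σ τ s m n a := by
  unfold configAt
  rw [PMF.map_apply, tsum_eq_single a]
  · simp
  · intro b hb
    simp [hb.symm]

lemma mem_support_configAt {s : S} {m : σ.Mem} {n : τ.Mem} {c : Config σ τ} :
    c ∈ (configAt σ τ s m n).support ↔
      c.entry.state = s ∧ c.sysMem = m ∧ c.envMem = n ∧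
        c.entry.action ∈ (actionDist σ τ s m n).support := by
  obtain ⟨⟨s', a⟩, m', n'⟩ := c
  simp only [configAt, PMF.support_map, Set.mem_image, Config.mk.injEq, Entry.mk.injEq]
  constructor
  · rintro ⟨b, hb, ⟨rfl, rfl⟩, rfl, rfl⟩
    exact ⟨rfl, rfl, rfl, hb⟩
  · rintro ⟨rfl, rfl, rfl, hb⟩
    exact ⟨a, hb, ⟨rfl, rfl⟩, rfl, rfl⟩

lemma mem_support_stepDist {c c' : Config σ τ} :
    c' ∈ (stepDist σ τ c).support ↔
      c'.entry.state ∈ (G.trans c.entry.state c.entry.action).support ∧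
      c'.sysMem = σ.update c.entry.state c.sysMem ∧
      c'.envMem = τ.update c.entry.state c.envMem ∧
      c'.entry.action ∈ (actionDist σ τ c'.entry.state c'.sysMem c'.envMem).support := by
  simp only [stepDist, PMF.mem_support_bind_iff, mem_support_configAt]
  constructor
  · rintro ⟨s, hs, rfl, h1, h2, h3⟩
    exact ⟨hs, h1, h2, h1 ▸ h2 ▸ h3⟩
  · rintro ⟨hs, h1, h2, h3⟩
    exact ⟨_, hs, rfl, h1, h2, h1 ▸ h2 ▸ h3⟩

lemma trans_le_stepKernel_state (c : Config σ τ) (s : S) :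
    G.trans c.entry.state c.entry.action s ≤ stepKernel σ τ c {x | x.entry.state = s} := by
  change _ ≤ (stepDist σ τ c).toMeasure _
  rw [stepDist, PMF.toMeasure_bind_apply _ _ _ MeasurableSet.of_discrete]
  refine le_trans ?_ (ENNReal.le_tsum s)
  rw [(PMF.toMeasure_apply_eq_one_iff _ MeasurableSet.of_discrete).2, mul_one]
  intro x hx
  exact (mem_support_configAt.1 hx).1

lemma trans_mul_actionDist_le_stepKernel (c : Config σ τ) (s : S) (a : A) :
    G.trans c.entry.state c.entry.action s *
        actionDist σ τ s (σ.update c.entry.state c.sysMem) (τ.update c.entry.state c.envMem) a ≤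
      stepKernel σ τ c {x | x.entry = ⟨s, a⟩} := by
  change _ ≤ (stepDist σ τ c).toMeasure _
  rw [stepDist, PMF.toMeasure_bind_apply _ _ _ MeasurableSet.of_discrete]
  refine le_trans ?_ (ENNReal.le_tsum s)
  gcongr
  rw [← configAt_apply, ← PMF.toMeasure_apply_singleton _ _ (MeasurableSet.singleton _)]
  refine measure_mono ?_
  rintro _ rfl
  rfl

end Support

/-- A run whose actions lie in `D`, whose steps are possible, and in which every successor of an
entry that occurs infinitely often, and every action in `E` of a state that occurs infinitely often,
occurs infinitely often. -/
structure IsFairRun (G : RabinGame S A) (D E : S → Set A) (s₀ : S) (π : Run S A) : Prop where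
  start : (π 0).state = s₀
  action_mem : ∀ n, (π n).action ∈ D (π n).state
  trans_ne_zero : ∀ n, G.trans (π n).state (π n).action (π (n + 1)).state ≠ 0
  frequently_next : ∀ s a s', (∃ᶠ n in atTop, π n = ⟨s, a⟩) → G.trans s a s' ≠ 0 →
    s' ∈ π.infStates
  frequently_action : ∀ s ∈ π.infStates, ∀ a ∈ E s, ∃ᶠ n in atTop, π n = ⟨s, a⟩

lemma frequently_succ {p : ℕ → Prop} (h : ∃ᶠ n in atTop, p n) : ∃ᶠ n in atTop, p (n + 1) := by
  rw [frequently_atTop] at h ⊢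
  intro N
  obtain ⟨m, hm, hp⟩ := h (N + 1)
  obtain ⟨k, rfl⟩ : ∃ k, m = k + 1 := ⟨m - 1, by omega⟩
  exact ⟨k, by omega, hp⟩

lemma frequently_of_succ {p : ℕ → Prop} (h : ∃ᶠ n in atTop, p (n + 1)) : ∃ᶠ n in atTop, p n := by
  rw [frequently_atTop] at h ⊢
  intro N
  obtain ⟨m, hm, hp⟩ := h N
  exact ⟨m + 1, by omega, hp⟩

/-- The bound in `hE` is uniform in the memories because Borel–Cantelli needs one lower bound for
all visits, while the memories may be infinite in number. For a memoryless system it holds at the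
system's states whatever the environment does. -/
lemma ae_isFairRun [Finite S] [Finite A] (σ : G.SysStrategy) (τ : G.EnvStrategy) (s₀ : S)
    {D E : S → Set A} (hD : ∀ s m n, (actionDist σ τ s m n).support ⊆ D s)
    (hE : ∀ s, ∀ a ∈ E s, ∃ p > 0, ∀ m n, p ≤ actionDist σ τ s m n a) :
    ∀ᵐ c ∂(configLaw σ τ s₀), IsFairRun G D E s₀ fun n => (c n).entry := by
  have hnext : ∀ᵐ c ∂(configLaw σ τ s₀), ∀ (e : Entry S A) (s' : S),
      G.trans e.state e.action s' ≠ 0 → (∃ᶠ n in atTop, c n ∈ {x | x.entry = e}) →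
        ∃ᶠ n in atTop, c (n + 1) ∈ {x | x.entry.state = s'} := by
    simp only [ae_all_iff]
    intro e s' h
    refine ae_frequently_of_le_stepDist σ τ s₀ _ _
      (ENNReal.toReal_pos h (PMF.apply_ne_top _ _)) ?_
    rintro x rfl
    exact ENNReal.toReal_mono (measure_ne_top _ _) (trans_le_stepKernel_state x s')
  have hact : ∀ᵐ c ∂(configLaw σ τ s₀), ∀ (e e' : Entry S A),
      G.trans e.state e.action e'.state ≠ 0 → e'.action ∈ E e'.state →
        (∃ᶠ n in atTop, c n ∈ {x | x.entry = e}) →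
        ∃ᶠ n in atTop, c (n + 1) ∈ {x | x.entry = e'} := by
    simp only [ae_all_iff]
    rintro e ⟨s', a'⟩ h ha
    obtain ⟨p, hp, hle⟩ := hE _ _ ha
    have hp1 : p ≠ ⊤ := ne_top_of_le_ne_top (PMF.apply_ne_top _ _) (hle σ.init τ.init)
    refine ae_frequently_of_le_stepDist σ τ s₀ _ _ (ENNReal.toReal_pos
      (mul_ne_zero h hp.ne') (ENNReal.mul_ne_top (PMF.apply_ne_top _ _) hp1)) ?_
    rintro x rfl
    refine ENNReal.toReal_mono (measure_ne_top _ _)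
      (le_trans ?_ (trans_mul_actionDist_le_stepKernel x s' a'))
    gcongr
    exact hle _ _
  filter_upwards [hnext, hact, ae_mem_support_configAt σ τ s₀, ae_mem_support_stepDist σ τ s₀]
    with c h1 h2 h3 h4
  rw [mem_support_configAt] at h3
  simp only [mem_support_stepDist] at h4
  refine ⟨h3.1, ?_, fun n => (h4 n).1, ?_, ?_⟩
  · rintro (_ | n)
    · have := h3.2.2.2
      rw [← h3.1] at this
      exact hD _ _ _ this
    · exact hD _ _ _ (h4 n).2.2.2
  · intro s a s' hf h
    exact frequently_of_succ (h1 ⟨s, a⟩ s' h hf)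
  · intro s hs a ha
    -- Pigeonhole: one fixed entry precedes `s` infinitely often, so `s` and the action `a` can be
    -- drawn together in one step from it.
    have hs' : ∃ᶠ n in atTop, ∃ e : Entry S A, (c n).entry = e ∧ (c (n + 1)).entry.state = s :=
      (frequently_succ hs).mono fun n hn => ⟨_, rfl, hn⟩
    obtain ⟨e, he⟩ := frequently_exists_iff_of_finite.1 hs'
    obtain ⟨n, hn1, hn2⟩ := he.exists
    refine frequently_of_succ (h2 e ⟨s, a⟩ ?_ ha (he.mono fun n hn => hn.1))
    have := (h4 n).1
    rw [hn1, hn2] at this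
    exact this

lemma exists_frequently_entry [Finite A] {π : Run S A} {s : S} (hs : s ∈ π.infStates) :
    ∃ a, ∃ᶠ n in atTop, π n = ⟨s, a⟩ := by
  refine frequently_exists_iff_of_finite.1 (Frequently.mono hs ?_)
  intro n hn
  exact ⟨(π n).action, by rw [← hn]⟩

lemma infStates_nonempty [Finite S] (π : Run S A) : π.infStates.Nonempty :=
  frequently_exists_iff_of_finite.1 (Frequently.of_forall fun n => ⟨(π n).state, rfl⟩)

lemma eventually_state_mem_infStates [Finite S] (π : Run S A) :
    ∀ᶠ n in atTop, (π n).state ∈ π.infStates := by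
  have h : ∀ᶠ n in atTop, ∀ s, s ∉ π.infStates → (π n).state ≠ s := by
    refine eventually_all.2 fun s => ?_
    by_cases hs : s ∈ π.infStates
    · exact Eventually.of_forall fun n h => absurd hs h
    · exact (not_frequently.1 hs).mono fun n hn _ => hn
  exact h.mono fun n hn => by_contra fun h' => hn _ h' rfl

lemma eventually_frequently_entry [Finite S] [Finite A] (π : Run S A) :
    ∀ᶠ n in atTop, ∃ᶠ k in atTop, π k = π n := by
  have h : ∀ᶠ n in atTop, ∀ e, ¬ (∃ᶠ k in atTop, π k = e) → π n ≠ e := by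
    refine eventually_all.2 fun e => ?_
    by_cases he : ∃ᶠ k in atTop, π k = e
    · exact Eventually.of_forall fun n h => absurd he h
    · exact (not_frequently.1 he).mono fun n hn _ => hn
  exact h.mono fun n hn => by_contra fun h' => hn _ h' rfl

/-- On the recurrent states of `π`, `F` consists of the recurrent actions of `π`, so fairness of `π`
traps `ω` there. Conversely, a late tail of `π` uses only recurrent entries; started at a recurrent
state of `ω`, it stays among these by fairness of `ω`, and it passes through every recurrent state
of `π`. -/
lemma IsFairRun.infStates_eq [Finite S] [Finite A] {D E F : S → Set A} {s₀ s₁ : S} {π ω : Run S A}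
    (hπ : IsFairRun G D E s₀ π) (hω : IsFairRun G F F s₁ ω)
    (hF : ∀ s ∈ π.infStates, F s = {a | ∃ᶠ n in atTop, π n = ⟨s, a⟩}) {m : ℕ}
    (hm : (ω m).state ∈ π.infStates) : ω.infStates = π.infStates := by
  have hstay : ∀ k, m ≤ k → (ω k).state ∈ π.infStates := by
    intro k hk
    induction k, hk using Nat.le_induction with
    | base => exact hm
    | succ k _ ih =>
      have ha := hω.action_mem k
      rw [hF _ ih] at ha
      exact hπ.frequently_next _ _ _ ha (hω.trans_ne_zero k)
  have hsub : ω.infStates ⊆ π.infStates := by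
    intro s hs
    obtain ⟨k, hk, rfl⟩ := frequently_atTop.1 hs m
    exact hstay k hk
  refine hsub.antisymm ?_
  obtain ⟨x, hx⟩ := infStates_nonempty ω
  obtain ⟨N, hN⟩ := eventually_atTop.1 (eventually_frequently_entry π)
  obtain ⟨k, hk, rfl⟩ := frequently_atTop.1 (hsub hx) N
  have hall : ∀ j, k ≤ j → (π j).state ∈ ω.infStates := by
    intro j hj
    induction j, hj using Nat.le_induction with
    | base => exact hx
    | succ j hj ih =>
      have ha : (π j).action ∈ F (π j).state := by
        rw [hF _ (hsub ih)]
        exact hN j (hk.trans hj)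
      exact hω.frequently_next _ _ _ (hω.frequently_action _ ih _ ha) (hπ.trans_ne_zero j)
  intro s hs
  obtain ⟨j, hj, rfl⟩ := frequently_atTop.1 hs k
  exact hall j hj

/-! ### Almost-sure winning depends only on the supports -/

lemma measurableSet_winningRuns [Finite S] : MeasurableSet G.winningRuns := by
  have h1 : ∀ s : S, MeasurableSet {π : Run S A | s ∈ π.infStates} := fun s =>
    measurableSet_frequently (B := fun n => (fun π : Run S A => π n) ⁻¹' {e : Entry S A | e.state = s})
      fun n => measurable_pi_apply n MeasurableSet.of_discrete
  have h2 : G.winningRuns = ⋃ D ∈ {D : Set S | ∃ p ∈ G.pairs, (D ∩ p.2).Nonempty ∧ D ∩ p.1 = ∅},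
      ⋂ s, {π : Run S A | s ∈ π.infStates ↔ s ∈ D} := by
    ext π
    simp only [winningRuns, Set.mem_ofPred_eq, Set.mem_iUnion, Set.mem_iInter, exists_prop]
    constructor
    · intro h
      exact ⟨_, h, fun s => Iff.rfl⟩
    · rintro ⟨D, h, hD⟩
      rwa [show π.infStates = D from Set.ext hD]
  rw [h2]
  refine MeasurableSet.biUnion (Set.to_countable _) fun D _ => MeasurableSet.iInter fun s => ?_
  exact (h1 s).iff (MeasurableSet.const _)

open Classical in
/-- The memoryless environment strategy that picks uniformly among the actions in `F`. -/
noncomputable def uniformEnv [Finite A] (F : S → Set A) (hne : ∀ s, (F s).Nonempty)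
    (hav : ∀ s, F s ⊆ G.avail s) : G.EnvStrategy where
  Mem := Unit
  countable_mem := inferInstance
  init := ()
  act s _ := PMF.uniformOfFinset (F s).toFinite.toFinset
    ((Set.Finite.toFinset_nonempty _).2 (hne s))
  update _ _ := ()
  act_avail s _ := by
    rw [PMF.support_uniformOfFinset]
    simpa using hav s

lemma support_uniformEnv [Finite A] (F : S → Set A) (hne : ∀ s, (F s).Nonempty)
    (hav : ∀ s, F s ⊆ G.avail s) (s : (G.sysᶜ : Set S)) (m : Unit) :
    ((uniformEnv F hne hav).act s m).support = F s := by
  simp [uniformEnv, PMF.support_uniformOfFinset]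

/-- The actions that may be taken at a state: those of `D` for the system, all available ones for
the environment. -/
def possibleActions (G : RabinGame S A) (D : G.sys → Set A) (s : S) : Set A :=
  {a | a ∈ G.avail s ∧ ∀ h : s ∈ G.sys, a ∈ D ⟨s, h⟩}

/-- The actions that a system with action sets `D` is sure to take, if memoryless. -/
def sureActions (G : RabinGame S A) (D : G.sys → Set A) (s : S) : Set A :=
  {a | ∃ h : s ∈ G.sys, a ∈ D ⟨s, h⟩}

lemma allowed_eq_support {P : Set S} (σ : G.Strategy P) (s : P) (m : σ.Mem) :
    σ.allowed s m = (σ.act s m).support := by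
  ext a
  simp only [Strategy.allowed, Set.mem_ofPred_eq, PMF.mem_support_iff, pos_iff_ne_zero]
  exact ⟨fun h => h.1, fun h => ⟨h, σ.act_avail s m h⟩⟩

lemma Strategy.IsMemoryless.eq_init {P : Set S} {σ : G.Strategy P} (h : σ.IsMemoryless)
    (m : σ.Mem) : m = σ.init := by
  obtain ⟨m₀, h₀⟩ := h
  rw [h₀ m, h₀ σ.init]

/-- A memoryless system strategy wins almost surely as soon as all fair runs that use its actions
are winning. -/
lemma almostSureWinning_of_forall_fair [Finite S] [Finite A] {σ : G.SysStrategy}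
    (hσ : σ.IsMemoryless)
    (h : ∀ s ∈ G.init, ∀ π, IsFairRun G (possibleActions G fun s => σ.allowed s σ.init)
      (sureActions G fun s => σ.allowed s σ.init) s π → π ∈ G.winningRuns) :
    AlmostSureWinning σ := by
  intro τ s hs
  refine (ae_map_iff (measurable_entries σ τ).aemeasurable measurableSet_winningRuns).2 ?_
  refine (ae_isFairRun σ τ s ?_ ?_).mono fun c hc => h s hs _ hc
  · intro s m n a ha
    unfold actionDist at ha
    split_ifs at ha with hsys
    · rw [hσ.eq_init m] at ha
      refine ⟨σ.act_avail _ _ ha, fun _ => ?_⟩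
      rwa [← allowed_eq_support] at ha
    · exact ⟨τ.act_avail _ _ ha, fun h => absurd h hsys⟩
  · rintro s a ⟨hsys, ha⟩
    have ha : a ∈ (σ.act ⟨s, hsys⟩ σ.init).support := by rwa [← allowed_eq_support]
    refine ⟨_, pos_iff_ne_zero.2 ha, fun m n => ?_⟩
    rw [actionDist, dif_pos hsys, hσ.eq_init m]

lemma AlmostSureWinning.winning_of_fair [Finite S] [Finite A] {σ : G.SysStrategy}
    (hσ : σ.IsMemoryless) (hwin : AlmostSureWinning σ) {s : S} (hs : s ∈ G.init) {π : Run S A}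
    (hπ : IsFairRun G (possibleActions G fun s => σ.allowed s σ.init)
      (sureActions G fun s => σ.allowed s σ.init) s π) : π ∈ G.winningRuns := by
  classical
  set D : G.sys → Set A := fun s => σ.allowed s σ.init with hDdef
  -- On the recurrent states of `π` the environment repeats the recurrent choices of `π`; elsewhere
  -- it keeps every action open, so that the initial part of `π` can be copied. At system states
  -- fairness forces `F` to be the support of `σ`.
  set F : S → Set A := fun s => if s ∈ π.infStates then {a | ∃ᶠ n in atTop, π n = ⟨s, a⟩}
    else possibleActions G D s with hFdef
  have hF : ∀ s ∈ π.infStates, F s = {a | ∃ᶠ n in atTop, π n = ⟨s, a⟩} := fun s hs => if_pos hs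
  have hFposs : ∀ s, F s ⊆ possibleActions G D s := by
    intro s a ha
    by_cases hs : s ∈ π.infStates
    · rw [hF s hs] at ha
      obtain ⟨n, hn⟩ := Frequently.exists ha
      have := hπ.action_mem n
      rwa [hn] at this
    · simpa [hFdef, hs] using ha
  have hav : ∀ s, F s ⊆ G.avail s := fun s a ha => (hFposs s ha).1
  have hFsys : ∀ s : G.sys, F s = D s := by
    intro s
    by_cases hs : (s : S) ∈ π.infStates
    · refine Set.Subset.antisymm (fun a ha => (hFposs s ha).2 s.2) fun a ha => ?_
      rw [hF _ hs]
      exact hπ.frequently_action _ hs _ ⟨s.2, ha⟩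
    · simp only [hFdef, hs, if_false]
      ext a
      exact ⟨fun ha => ha.2 s.2, fun ha => ⟨ha.2, fun _ => ha⟩⟩
  have hne : ∀ s, (F s).Nonempty := by
    intro s
    by_cases hsys : s ∈ G.sys
    · rw [hFsys ⟨s, hsys⟩]
      simp only [hDdef, allowed_eq_support]
      exact PMF.support_nonempty _
    · by_cases hs : s ∈ π.infStates
      · rw [hF s hs]
        exact exists_frequently_entry hs
      · simp only [hFdef, hs, if_false]
        obtain ⟨a, ha⟩ := G.avail_nonempty s
        exact ⟨a, ha, fun h => absurd h hsys⟩
  set τ : G.EnvStrategy := uniformEnv F hne hav with hτ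
  have hsupp : ∀ s m n, (actionDist σ τ s m n).support = F s := by
    intro s m n
    unfold actionDist
    split_ifs with hsys
    · rw [hσ.eq_init m, ← allowed_eq_support]
      exact (hFsys ⟨s, hsys⟩).symm
    · exact support_uniformEnv F hne hav ⟨s, hsys⟩ n
  have hfair := ae_isFairRun σ τ s (D := F) (E := F) (fun s m n => (hsupp s m n).le) (by
    intro s a ha
    refine ⟨actionDist σ τ s σ.init τ.init a, pos_iff_ne_zero.2 ?_, fun m n => ?_⟩
    · rwa [← hsupp s σ.init τ.init] at ha
    · rw [hσ.eq_init m, show n = τ.init from Subsingleton.elim (α := Unit) n ()])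
  have hex : ∃ m, (π m).state ∈ π.infStates :=
    (eventually_state_mem_infStates π).exists
  -- Only the path up to the first recurrent state of `π` is copied: at the states before it, `F`
  -- contains all possible actions, hence the one that `π` takes.
  have hpos : ∀ n, n ≤ Nat.find hex → ∀ a ∈ F (π n).state,
      0 < configLaw σ τ s {c | c n = ⟨⟨(π n).state, a⟩, σ.init, τ.init⟩} := by
    intro n
    induction n with
    | zero =>
      intro _ a ha
      refine configLaw_eval_zero_pos σ τ s (mem_support_configAt.2 ⟨hπ.start, rfl, rfl, ?_⟩)
      rwa [hsupp, ← hπ.start]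
    | succ n ih =>
      intro hn a ha
      have hnot : (π n).state ∉ π.infStates := Nat.find_min hex hn
      have hact : (π n).action ∈ F (π n).state := by
        simp only [hFdef, hnot, if_false]
        exact hπ.action_mem n
      refine configLaw_eval_succ_pos σ τ s (ih (by omega) _ hact)
        (mem_support_stepDist.2 ⟨hπ.trans_ne_zero n, (hσ.eq_init _).symm, rfl, ?_⟩)
      rwa [hsupp]
  obtain ⟨a, ha⟩ := hne (π (Nat.find hex)).state
  have hwin' := ae_of_ae_map (measurable_entries σ τ).aemeasurable (hwin τ s hs)
  -- An event of positive probability meets the almost sure events, which gives one play that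
  -- reaches the recurrent states of `π`, is fair and wins.
  obtain ⟨c, hc, hc1, hc2⟩ := ((frequently_ae_iff.2 (hpos _ le_rfl a ha).ne').and_eventually
    (hfair.and hwin')).exists
  have heq := hπ.infStates_eq hc1 hF (m := Nat.find hex) (by
    rw [hc]
    exact Nat.find_spec hex)
  simp only [winningRuns, Set.mem_ofPred_eq] at hc2 ⊢
  rwa [heq] at hc2

lemma AlmostSureWinning.of_allowed_eq [Finite S] [Finite A] {σ σ' : G.SysStrategy}
    (hσ : σ.IsMemoryless) (hσ' : σ'.IsMemoryless)
    (h : ∀ s : G.sys, σ'.allowed s σ'.init = σ.allowed s σ.init) (hwin : AlmostSureWinning σ) :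
    AlmostSureWinning σ' := by
  refine almostSureWinning_of_forall_fair hσ' fun s hs π hπ => ?_
  simp only [h] at hπ
  exact hwin.winning_of_fair hσ hs hπ

/-! ### Advantages and one-step expectations -/

/-- The expected reward of taking `a` at `s` and collecting `u` at the next state, discounted. -/
noncomputable def stepValue [Fintype S] (G : RabinGame S A) (R : S → A → S → ℝ≥0) (γ : ℝ)
    (u : S → ℝ) (s : S) (a : A) : ℝ :=
  ∑ s', (G.trans s a s').toReal * ((R s a s' : ℝ) + γ * u s')

/-- The gain of taking the action `a` at `s`, measured by the value function `u`. -/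
noncomputable def advantage [Fintype S] (G : RabinGame S A) (R : S → A → S → ℝ≥0) (γ : ℝ)
    (u : S → ℝ) (s : S) (a : A) : ℝ :=
  G.stepValue R γ u s a - u s

section Integrals

variable [Fintype S] [Fintype A] (σ : G.SysStrategy) (τ : G.EnvStrategy)

noncomputable instance fintype_entry : Fintype (Entry S A) := Fintype.ofFinite _

omit [Fintype S] [Fintype A] in
lemma measurable_config_entry : Measurable (Config.entry : Config σ τ → Entry S A) :=
  measurable_from_top

lemma integral_config_entry (p : PMF (Config σ τ)) (g : Entry S A → ℝ) :
    ∫ c, g c.entry ∂p.toMeasure = ∑ e, (p.map Config.entry e).toReal * g e := by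
  have h : ∫ c, g c.entry ∂p.toMeasure = ∫ e, g e ∂(p.map Config.entry).toMeasure := by
    rw [← PMF.toMeasure_map _ _ (measurable_config_entry σ τ),
      integral_map (measurable_config_entry σ τ).aemeasurable
        (measurable_from_top).aestronglyMeasurable]
  rw [h, PMF.integral_eq_sum]
  simp only [smul_eq_mul]

lemma sum_configAt_map_entry (s : S) (m : σ.Mem) (n : τ.Mem) (g : Entry S A → ℝ) :
    ∑ e, ((configAt σ τ s m n).map Config.entry e).toReal * g e =
      ∑ a, (actionDist σ τ s m n a).toReal * g ⟨s, a⟩ := by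
  rw [configAt, PMF.map_comp, PMF.sum_map_toReal_mul]
  rfl

lemma integral_configAt (s : S) (m : σ.Mem) (n : τ.Mem) (g : Entry S A → ℝ) :
    ∫ c, g c.entry ∂(configAt σ τ s m n).toMeasure =
      ∑ a, (actionDist σ τ s m n a).toReal * g ⟨s, a⟩ := by
  rw [integral_config_entry, sum_configAt_map_entry]

lemma integral_stepKernel (c : Config σ τ) (g : Entry S A → ℝ) :
    ∫ c', g c'.entry ∂(stepKernel σ τ c) =
      ∑ s, (G.trans c.entry.state c.entry.action s).toReal *
        ∑ a, (actionDist σ τ s (σ.update c.entry.state c.sysMem)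
          (τ.update c.entry.state c.envMem) a).toReal * g ⟨s, a⟩ := by
  change ∫ c', g c'.entry ∂(stepDist σ τ c).toMeasure = _
  rw [integral_config_entry, stepDist, PMF.map_bind, PMF.sum_bind_toReal_mul]
  simp only [sum_configAt_map_entry]

lemma integral_stepKernel_state (c : Config σ τ) (g : S → ℝ) :
    ∫ c', g c'.entry.state ∂(stepKernel σ τ c) =
      ∑ s, (G.trans c.entry.state c.entry.action s).toReal * g s := by
  rw [integral_stepKernel σ τ c fun e => g e.state]
  simp only [← Finset.sum_mul, PMF.sum_toReal, one_mul]

lemma exists_abs_le {ι : Type*} [Finite ι] (f : ι → ℝ) : ∃ M, ∀ i, |f i| ≤ M := by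
  obtain ⟨M, hM⟩ := (Set.finite_range fun i => |f i|).bddAbove
  exact ⟨M, fun i => hM ⟨i, rfl⟩⟩

lemma integrable_comp_of_finite {Ω ι : Type*} [MeasurableSpace Ω] {μ : Measure Ω}
    [IsFiniteMeasure μ] [Finite ι] [MeasurableSpace ι] [DiscreteMeasurableSpace ι] (g : ι → ℝ)
    {f : Ω → ι} (hf : Measurable f) : Integrable (fun x => g (f x)) μ := by
  obtain ⟨M, hM⟩ := exists_abs_le g
  exact Integrable.of_bound (Measurable.of_discrete.comp hf).aestronglyMeasurable M
    (ae_of_all _ fun x => hM _)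

variable (s₀ : S)

lemma integral_eval_zero (g : Entry S A → ℝ) :
    ∫ c, g (c 0).entry ∂(configLaw σ τ s₀) =
      ∑ a, (actionDist σ τ s₀ σ.init τ.init a).toReal * g ⟨s₀, a⟩ := by
  rw [← integral_configAt, ← configLaw_map_zero, integral_map (measurable_pi_apply 0).aemeasurable
    (Measurable.of_discrete.aestronglyMeasurable)]

lemma integral_pair (φ : Entry S A × Entry S A → ℝ) (n : ℕ) :
    ∫ c, φ ((c n).entry, (c (n + 1)).entry) ∂(configLaw σ τ s₀) =
      ∫ c, ∫ y, φ ((c n).entry, y.entry) ∂(stepKernel σ τ (c n)) ∂(configLaw σ τ s₀) := by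
  have hm : Measurable fun p : Config σ τ × Config σ τ => (p.1.entry, p.2.entry) :=
    ((measurable_config_entry σ τ).comp measurable_fst).prodMk
      ((measurable_config_entry σ τ).comp measurable_snd)
  have h1 : ∫ c, φ ((c n).entry, (c (n + 1)).entry) ∂(configLaw σ τ s₀) =
      ∫ p, φ (p.1.entry, p.2.entry) ∂((configLaw σ τ s₀).map fun c => (c n, c (n + 1))) := by
    have hpair : Measurable fun c : ℕ → Config σ τ => (c n, c (n + 1)) :=
      (measurable_pi_apply n).prodMk (measurable_pi_apply (n + 1))
    have hφ : Measurable fun p : Config σ τ × Config σ τ => φ (p.1.entry, p.2.entry) :=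
      (Measurable.of_discrete (f := φ)).comp hm
    exact (integral_map hpair.aemeasurable hφ.aestronglyMeasurable).symm
  have : IsProbabilityMeasure ((configLaw σ τ s₀).map fun c => c n) :=
    Measure.isProbabilityMeasure_map (measurable_pi_apply n).aemeasurable
  rw [h1, configLaw_map_pair, Measure.integral_compProd (integrable_comp_of_finite φ hm),
    integral_map (measurable_pi_apply n).aemeasurable Measurable.of_discrete.aestronglyMeasurable]

omit [Fintype S] [Fintype A] in
lemma measurable_eval_entry (n : ℕ) :
    Measurable fun c : ℕ → Config σ τ => (c n).entry :=
  (measurable_config_entry σ τ).comp (measurable_pi_apply n)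

/-- The sign is assumed only for averages over the action at each state and memory pair, so the
expectation at a later time is first conditioned on the preceding configuration. -/
lemma integral_eval_nonneg {g : Entry S A → ℝ}
    (hg : ∀ s m n, 0 ≤ ∑ a, (actionDist σ τ s m n a).toReal * g ⟨s, a⟩) (n : ℕ) :
    0 ≤ ∫ c, g (c n).entry ∂(configLaw σ τ s₀) := by
  cases n with
  | zero =>
    rw [integral_eval_zero]
    exact hg _ _ _
  | succ n =>
    rw [integral_pair σ τ s₀ (fun p => g p.2) n]
    refine integral_nonneg fun c => ?_
    simp only [integral_stepKernel]
    exact Finset.sum_nonneg fun s _ => mul_nonneg ENNReal.toReal_nonneg (hg _ _ _)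

lemma integral_stepValue (R : S → A → S → ℝ≥0) (γ : ℝ) (u : S → ℝ) (n : ℕ) :
    ∫ c, G.stepValue R γ u (c n).entry.state (c n).entry.action ∂(configLaw σ τ s₀) =
      ∫ c, (R (c n).entry.state (c n).entry.action (c (n + 1)).entry.state : ℝ)
        ∂(configLaw σ τ s₀) +
      γ * ∫ c, u (c (n + 1)).entry.state ∂(configLaw σ τ s₀) := by
  rw [← integral_const_mul, ← integral_add]
  · rw [integral_pair σ τ s₀ (fun p => (R p.1.state p.1.action p.2.state : ℝ) + γ * u p.2.state) n]
    refine integral_congr_ae (ae_of_all _ fun c => ?_)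
    exact (integral_stepKernel_state σ τ (c n)
      fun s => (R (c n).entry.state (c n).entry.action s : ℝ) + γ * u s).symm
  · exact integrable_comp_of_finite
      (fun p : Entry S A × Entry S A => (R p.1.state p.1.action p.2.state : ℝ))
      ((measurable_eval_entry σ τ n).prodMk (measurable_eval_entry σ τ (n + 1)))
  · exact integrable_comp_of_finite (fun e : Entry S A => γ * u e.state)
      (measurable_eval_entry σ τ (n + 1))

end Integrals

/-! ### The value as a discounted sum of advantages -/

section Value

variable [Fintype S] [Fintype A] (σ : G.SysStrategy) (τ : G.EnvStrategy) (s₀ : S)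
  (R : S → A → S → ℝ≥0) {γ : ℝ}

lemma summable_discounted (hγ₀ : 0 < γ) (hγ₁ : γ < 1) {f : ℕ → ℝ} {M : ℝ} (hf : ∀ n, |f n| ≤ M) :
    Summable fun n => γ ^ n * f n := by
  refine Summable.of_norm_bounded ((summable_geometric_of_lt_one hγ₀.le hγ₁).mul_right M) ?_
  intro n
  rw [Real.norm_eq_abs, abs_mul, abs_of_nonneg (pow_nonneg hγ₀.le n)]
  exact mul_le_mul_of_nonneg_left (hf n) (pow_nonneg hγ₀.le n)

lemma exists_abs_reward_le : ∃ M : ℝ, ∀ s a s', |(R s a s' : ℝ)| ≤ M := by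
  obtain ⟨M, hM⟩ := exists_abs_le fun p : S × A × S => (R p.1 p.2.1 p.2.2 : ℝ)
  exact ⟨M, fun s a s' => hM (s, a, s')⟩

lemma measurable_discountedReward (hγ₀ : 0 < γ) (hγ₁ : γ < 1) :
    Measurable fun π : Run S A => π.discountedReward R γ := by
  obtain ⟨M, hM⟩ := exists_abs_reward_le R
  refine measurable_of_tendsto_metrizable (f := fun N (π : Run S A) => ∑ t ∈ Finset.range N,
    γ ^ t * (R (π t).state (π t).action (π (t + 1)).state : ℝ)) (fun N => ?_) ?_
  · refine Finset.measurable_sum _ fun t _ => ?_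
    exact (Measurable.of_discrete (f := fun p : Entry S A × Entry S A =>
      γ ^ t * (R p.1.state p.1.action p.2.state : ℝ))).comp
        ((measurable_pi_apply (X := fun _ => Entry S A) t).prodMk (measurable_pi_apply (t + 1)))
  · exact tendsto_pi_nhds.2 fun π =>
      (summable_discounted hγ₀ hγ₁ fun n => hM _ _ _).hasSum.tendsto_sum_nat

omit [Fintype S] [Fintype A] in
lemma value_nonneg (hγ₀ : 0 < γ) : 0 ≤ value R γ s₀ σ τ :=
  integral_nonneg fun _ => tsum_nonneg fun t => mul_nonneg (pow_nonneg hγ₀.le t) (R _ _ _).2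

lemma hasSum_value (hγ₀ : 0 < γ) (hγ₁ : γ < 1) :
    HasSum (fun n => γ ^ n * ∫ c, (R (c n).entry.state (c n).entry.action
      (c (n + 1)).entry.state : ℝ) ∂(configLaw σ τ s₀)) (value R γ s₀ σ τ) := by
  obtain ⟨M, hM⟩ := exists_abs_reward_le R
  have hint : ∀ n, Integrable (fun c : ℕ → Config σ τ => γ ^ n * (R (c n).entry.state
      (c n).entry.action (c (n + 1)).entry.state : ℝ)) (configLaw σ τ s₀) := fun n =>
    integrable_comp_of_finite
      (fun p : Entry S A × Entry S A => γ ^ n * (R p.1.state p.1.action p.2.state : ℝ))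
      ((measurable_eval_entry σ τ n).prodMk (measurable_eval_entry σ τ (n + 1)))
  have hsum : Summable fun n => ∫ c : ℕ → Config σ τ, ‖γ ^ n * (R (c n).entry.state
      (c n).entry.action (c (n + 1)).entry.state : ℝ)‖ ∂(configLaw σ τ s₀) := by
    refine Summable.of_nonneg_of_le (fun n => integral_nonneg fun c => norm_nonneg _) (fun n => ?_)
      ((summable_geometric_of_lt_one hγ₀.le hγ₁).mul_right M)
    refine (integral_mono (hint n).norm (integrable_const (γ ^ n * M)) fun c => ?_).trans
      (by simp)
    rw [Real.norm_eq_abs, abs_mul, abs_of_nonneg (pow_nonneg hγ₀.le n)]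
    exact mul_le_mul_of_nonneg_left (hM _ _ _) (pow_nonneg hγ₀.le n)
  have h := hasSum_integral_of_summable_integral_norm hint hsum
  simp only [integral_const_mul] at h
  have hvalue : value R γ s₀ σ τ =
      ∫ c, Run.discountedReward R γ (fun n => (c n).entry) ∂(configLaw σ τ s₀) :=
    integral_map (measurable_entries σ τ).aemeasurable
      (measurable_discountedReward R hγ₀ hγ₁).aestronglyMeasurable
  rw [hvalue]
  exact h

/-- Telescoping: the expected advantage at time `n` is the expected reward plus `γ * E (n + 1) - E
n`, where `E n` is the expectation of `u` at time `n`. After discounting only `-E 0 = -u s₀`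
survives. -/
lemma hasSum_advantage (hγ₀ : 0 < γ) (hγ₁ : γ < 1) (u : S → ℝ) :
    HasSum (fun n => γ ^ n * ∫ c, G.advantage R γ u (c n).entry.state (c n).entry.action
      ∂(configLaw σ τ s₀)) (value R γ s₀ σ τ - u s₀) := by
  set E : ℕ → ℝ := fun n => ∫ c, u (c n).entry.state ∂(configLaw σ τ s₀) with hE
  obtain ⟨M, hM⟩ := exists_abs_le u
  have hEM : ∀ n, |E n| ≤ M := fun n => by
    have := norm_integral_le_of_norm_le_const (μ := configLaw σ τ s₀)
      (f := fun c => u (c n).entry.state) (ae_of_all _ fun c => hM _)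
    simpa using this
  have hE0 : E 0 = u s₀ := by
    rw [hE]
    simp only
    rw [integral_eval_zero σ τ s₀ fun e => u e.state]
    simp only
    rw [← Finset.sum_mul, PMF.sum_toReal, one_mul]
  have hs := (summable_discounted hγ₀ hγ₁ hEM).hasSum
  have hs' := (hasSum_nat_add_iff' 1).2 hs
  have h := (hasSum_value σ τ s₀ R hγ₀ hγ₁).add (hs'.sub hs)
  convert h using 1
  · ext n
    have : ∫ c, G.advantage R γ u (c n).entry.state (c n).entry.action ∂(configLaw σ τ s₀) =
        ∫ c, G.stepValue R γ u (c n).entry.state (c n).entry.action ∂(configLaw σ τ s₀) - E n :=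
      integral_sub
        (integrable_comp_of_finite (fun e : Entry S A => G.stepValue R γ u e.state e.action)
          (measurable_eval_entry σ τ n))
        (integrable_comp_of_finite (fun e : Entry S A => u e.state) (measurable_eval_entry σ τ n))
    rw [this, integral_stepValue]
    simp only [hE]
    ring
  · simp [hE0]
    ring

/-- If no action distribution loses more than `η` with respect to `u`, then the value is at least
`u` up to `η / (1 - γ)`. -/
lemma le_value_of_advantage (hγ₀ : 0 < γ) (hγ₁ : γ < 1) {u : S → ℝ} {η : ℝ}
    (h : ∀ s m n, -η ≤ ∑ a, (actionDist σ τ s m n a).toReal * G.advantage R γ u s a) :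
    u s₀ - η / (1 - γ) ≤ value R γ s₀ σ τ := by
  have hs := hasSum_advantage σ τ s₀ R hγ₀ hγ₁ u
  have hgeo := (hasSum_geometric_of_lt_one hγ₀.le hγ₁).mul_right (-η)
  have hle := hasSum_le (fun n => ?_) hgeo hs
  · have : (1 - γ)⁻¹ * -η = -(η / (1 - γ)) := by ring
    linarith
  · refine mul_le_mul_of_nonneg_left ?_ (pow_nonneg hγ₀.le n)
    have hnn := integral_eval_nonneg σ τ s₀
      (g := fun e => G.advantage R γ u e.state e.action + η) (fun s m n => by
        simp only [mul_add, Finset.sum_add_distrib, ← Finset.sum_mul, PMF.sum_toReal, one_mul]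
        linarith [h s m n]) n
    rw [integral_add (integrable_comp_of_finite
      (fun e : Entry S A => G.advantage R γ u e.state e.action) (measurable_eval_entry σ τ n))
      (integrable_const _)] at hnn
    simp only [integral_const, probReal_univ, one_smul] at hnn
    linarith

lemma value_le_of_advantage (hγ₀ : 0 < γ) (hγ₁ : γ < 1) {u : S → ℝ}
    (h : ∀ s m n, ∑ a, (actionDist σ τ s m n a).toReal * G.advantage R γ u s a ≤ 0) :
    value R γ s₀ σ τ ≤ u s₀ := by
  have hs := hasSum_advantage σ τ s₀ R hγ₀ hγ₁ u
  have hle := hasSum_le (fun n => ?_) hs hasSum_zero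
  · linarith
  · refine mul_nonpos_of_nonneg_of_nonpos (pow_nonneg hγ₀.le n) ?_
    have hnn := integral_eval_nonneg σ τ s₀
      (g := fun e => -G.advantage R γ u e.state e.action) (fun s m n => by
        simp only [mul_neg, Finset.sum_neg_distrib]
        linarith [h s m n]) n
    rw [integral_neg] at hnn
    linarith

end Value

/-! ### Shapley's equations and the optimal value -/

section Optimal

variable [Fintype S] [Fintype A]

lemma abs_sup'_sub_sup'_le {ι : Type*} {F : Finset ι} (hF : F.Nonempty) {f g : ι → ℝ} {K : ℝ}
    (h : ∀ i, |f i - g i| ≤ K) : |F.sup' hF f - F.sup' hF g| ≤ K := by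
  rw [abs_sub_le_iff]
  constructor
  · rw [sub_le_iff_le_add']
    refine Finset.sup'_le _ _ fun i hi => ?_
    linarith [Finset.le_sup' g hi, (abs_sub_le_iff.1 (h i)).1]
  · rw [sub_le_iff_le_add']
    refine Finset.sup'_le _ _ fun i hi => ?_
    linarith [Finset.le_sup' f hi, (abs_sub_le_iff.1 (h i)).2]

lemma abs_inf'_sub_inf'_le {ι : Type*} {F : Finset ι} (hF : F.Nonempty) {f g : ι → ℝ} {K : ℝ}
    (h : ∀ i, |f i - g i| ≤ K) : |F.inf' hF f - F.inf' hF g| ≤ K := by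
  rw [abs_sub_le_iff]
  constructor
  · rw [sub_le_comm]
    refine Finset.le_inf' _ _ fun i hi => ?_
    linarith [Finset.inf'_le f hi, (abs_sub_le_iff.1 (h i)).1]
  · rw [sub_le_comm]
    refine Finset.le_inf' _ _ fun i hi => ?_
    linarith [Finset.inf'_le g hi, (abs_sub_le_iff.1 (h i)).2]

omit [Fintype A] in
lemma abs_stepValue_sub_le (R : S → A → S → ℝ≥0) {γ : ℝ} (hγ₀ : 0 < γ) (u v : S → ℝ) (s : S)
    (a : A) : |G.stepValue R γ u s a - G.stepValue R γ v s a| ≤ γ * dist u v := by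
  have h : G.stepValue R γ u s a - G.stepValue R γ v s a =
      ∑ s', (G.trans s a s').toReal * (γ * (u s' - v s')) := by
    rw [stepValue, stepValue, ← Finset.sum_sub_distrib]
    exact Finset.sum_congr rfl fun s' _ => by ring
  rw [h]
  calc _ ≤ ∑ s', |(G.trans s a s').toReal * (γ * (u s' - v s'))| := Finset.abs_sum_le_sum_abs _ _
    _ ≤ ∑ s', (G.trans s a s').toReal * (γ * dist u v) := by
      refine Finset.sum_le_sum fun s' _ => ?_
      rw [abs_mul, abs_mul, abs_of_nonneg ENNReal.toReal_nonneg, abs_of_pos hγ₀]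
      gcongr
      exact dist_le_pi_dist u v s'
    _ = γ * dist u v := by rw [← Finset.sum_mul, PMF.sum_toReal, one_mul]

/-- The discounted game has a value function that solves Shapley's equations. -/
lemma exists_shapley_solution (G : RabinGame S A) (R : S → A → S → ℝ≥0) {γ : ℝ} (hγ₀ : 0 < γ)
    (hγ₁ : γ < 1) : ∃ v : S → ℝ,
      (∀ s ∈ G.sys, ∀ a ∈ G.avail s, G.advantage R γ v s a ≤ 0) ∧
      (∀ s ∉ G.sys, ∀ a ∈ G.avail s, 0 ≤ G.advantage R γ v s a) ∧
      ∀ s, ∃ a ∈ G.avail s, G.advantage R γ v s a = 0 := by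
  classical
  set F : S → Finset A := fun s => (G.avail s).toFinite.toFinset with hFdef
  have hF : ∀ s, (F s).Nonempty := fun s =>
    (Set.Finite.toFinset_nonempty _).2 (G.avail_nonempty s)
  have hmem : ∀ s a, a ∈ F s ↔ a ∈ G.avail s := fun s a => by simp [hFdef]
  set Φ : (S → ℝ) → S → ℝ := fun u s =>
    if s ∈ G.sys then (F s).sup' (hF s) (G.stepValue R γ u s)
    else (F s).inf' (hF s) (G.stepValue R γ u s) with hΦ
  -- Maximum and minimum are 1-Lipschitz in the sup norm, so the discount makes `Φ` a contraction
  -- and Banach's theorem gives the solution.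
  have hcontr : ContractingWith ⟨γ, hγ₀.le⟩ Φ := by
    refine ⟨hγ₁, LipschitzWith.of_dist_le_mul fun u v => ?_⟩
    refine (dist_pi_le_iff (mul_nonneg hγ₀.le dist_nonneg)).2 fun s => ?_
    rw [Real.dist_eq]
    simp only [hΦ]
    split_ifs
    · exact abs_sup'_sub_sup'_le (hF s) fun a => abs_stepValue_sub_le R hγ₀ u v s a
    · exact abs_inf'_sub_inf'_le (hF s) fun a => abs_stepValue_sub_le R hγ₀ u v s a
  obtain ⟨v, hv⟩ : ∃ v, Φ v = v := ⟨_, hcontr.fixedPoint_isFixedPt⟩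
  have hsys : ∀ s ∈ G.sys, v s = (F s).sup' (hF s) (G.stepValue R γ v s) := fun s hs => by
    conv_lhs => rw [← hv]
    simp only [hΦ, hs, if_true]
  have henv : ∀ s ∉ G.sys, v s = (F s).inf' (hF s) (G.stepValue R γ v s) := fun s hs => by
    conv_lhs => rw [← hv]
    simp only [hΦ, hs, if_false]
  refine ⟨v, fun s hs a ha => ?_, fun s hs a ha => ?_, fun s => ?_⟩
  · rw [advantage, sub_nonpos]
    exact (Finset.le_sup' (G.stepValue R γ v s) ((hmem s a).2 ha)).trans (hsys s hs).ge
  · rw [advantage, sub_nonneg]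
    exact (henv s hs).le.trans (Finset.inf'_le (G.stepValue R γ v s) ((hmem s a).2 ha))
  · by_cases hs : s ∈ G.sys
    · obtain ⟨a, ha, h⟩ := Finset.exists_mem_eq_sup' (hF s) (G.stepValue R γ v s)
      exact ⟨a, (hmem s a).1 ha, by rw [advantage, ← h, ← hsys s hs, sub_self]⟩
    · obtain ⟨a, ha, h⟩ := Finset.exists_mem_eq_inf' (hF s) (G.stepValue R γ v s)
      exact ⟨a, (hmem s a).1 ha, by rw [advantage, ← h, ← henv s hs, sub_self]⟩

/-- The memoryless strategy with the given action distributions. -/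
def memorylessStrategy {P : Set S} (p : S → PMF A) (hp : ∀ s ∈ P, (p s).support ⊆ G.avail s) :
    G.Strategy P where
  Mem := Unit
  countable_mem := inferInstance
  init := ()
  act s _ := p s
  update _ _ := ()
  act_avail s _ := hp s s.2

instance nonempty_strategy (P : Set S) : Nonempty (G.Strategy P) :=
  ⟨memorylessStrategy (fun s => PMF.pure (G.avail_nonempty s).some) fun s _ => by
    simpa using (G.avail_nonempty s).some_mem⟩

lemma sum_pure_toReal_mul (b : A) (f : A → ℝ) :
    ∑ a, (PMF.pure b a).toReal * f a = f b := by
  classical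
  rw [Finset.sum_eq_single b]
  · simp
  · intro a _ ha
    simp [ha]
  · simp

lemma sum_toReal_mul_nonneg {p : PMF A} {f : A → ℝ} (h : ∀ a ∈ p.support, 0 ≤ f a) :
    0 ≤ ∑ a, (p a).toReal * f a := by
  refine Finset.sum_nonneg fun a _ => ?_
  by_cases ha : a ∈ p.support
  · exact mul_nonneg ENNReal.toReal_nonneg (h a ha)
  · rw [PMF.mem_support_iff, not_not] at ha
    simp [ha]

omit [Fintype S] [Fintype A] in
lemma bddBelow_value (R : S → A → S → ℝ≥0) {γ : ℝ} (hγ₀ : 0 < γ) (s : S) (σ : G.SysStrategy) :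
    BddBelow (Set.range fun τ : G.EnvStrategy => value R γ s σ τ) :=
  ⟨0, by rintro _ ⟨τ, rfl⟩; exact value_nonneg σ τ s R hγ₀⟩

/-- A system strategy that loses at most `η` per step with respect to `v`, and the environment
never gains with respect to `v`: the strategy guarantees `v` up to `η / (1 - γ)`. -/
lemma le_strategyValue (R : S → A → S → ℝ≥0) {γ : ℝ} (hγ₀ : 0 < γ) (hγ₁ : γ < 1) {v : S → ℝ}
    (henv : ∀ s ∉ G.sys, ∀ a ∈ G.avail s, 0 ≤ G.advantage R γ v s a) {η : ℝ} (hη : 0 ≤ η)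
    (σ : G.SysStrategy)
    (hσ : ∀ (s : G.sys) m, -η ≤ ∑ a, (σ.act s m a).toReal * G.advantage R γ v s a) (s : S) :
    v s - η / (1 - γ) ≤ strategyValue R γ s σ := by
  refine le_ciInf fun τ => le_value_of_advantage σ τ s R hγ₀ hγ₁ fun s m n => ?_
  unfold actionDist
  split_ifs with hs
  · exact hσ ⟨s, hs⟩ m
  · refine le_trans (neg_nonpos.2 hη) ?_
    exact sum_toReal_mul_nonneg fun a ha => henv s hs a (τ.act_avail _ _ ha)

/-- The environment answers every system strategy with a fixed action of advantage zero at each of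
its states; the system itself can never gain. -/
lemma strategyValue_le (R : S → A → S → ℝ≥0) {γ : ℝ} (hγ₀ : 0 < γ) (hγ₁ : γ < 1) {v : S → ℝ}
    (hsys : ∀ s ∈ G.sys, ∀ a ∈ G.avail s, G.advantage R γ v s a ≤ 0)
    (hopt : ∀ s, ∃ a ∈ G.avail s, G.advantage R γ v s a = 0) (σ : G.SysStrategy) (s : S) :
    strategyValue R γ s σ ≤ v s := by
  choose b hb hb0 using hopt
  set τ : G.EnvStrategy := memorylessStrategy (fun s => PMF.pure (b s))
    (fun s _ => by simpa using hb s) with hτ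
  refine (ciInf_le (bddBelow_value R hγ₀ s σ) τ).trans ?_
  refine value_le_of_advantage σ τ s R hγ₀ hγ₁ fun s m n => ?_
  unfold actionDist
  split_ifs with hs
  · have := sum_toReal_mul_nonneg (p := σ.act ⟨s, hs⟩ m)
      (f := fun a => -G.advantage R γ v s a)
      (fun a ha => neg_nonneg.2 (hsys s hs a (σ.act_avail _ _ ha)))
    simp only [mul_neg, Finset.sum_neg_distrib] at this
    linarith
  · exact ((sum_pure_toReal_mul (b s) _).trans (hb0 s)).le

/-- The optimal value function is the solution of Shapley's equations. -/
lemma optimalValue_eq (R : S → A → S → ℝ≥0) {γ : ℝ} (hγ₀ : 0 < γ) (hγ₁ : γ < 1) {v : S → ℝ}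
    (hsys : ∀ s ∈ G.sys, ∀ a ∈ G.avail s, G.advantage R γ v s a ≤ 0)
    (henv : ∀ s ∉ G.sys, ∀ a ∈ G.avail s, 0 ≤ G.advantage R γ v s a)
    (hopt : ∀ s, ∃ a ∈ G.avail s, G.advantage R γ v s a = 0) :
    G.optimalValue R γ = v := by
  ext s
  refine le_antisymm (ciSup_le fun σ => strategyValue_le R hγ₀ hγ₁ hsys hopt σ s) ?_
  choose b hb hb0 using id hopt
  set σ : G.SysStrategy := memorylessStrategy (fun s => PMF.pure (b s))
    (fun s _ => by simpa using hb s) with hσ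
  have h := le_strategyValue R hγ₀ hγ₁ henv le_rfl σ (fun s m => by
    rw [neg_zero]
    exact ((sum_pure_toReal_mul (b s) _).trans (hb0 s)).ge) s
  rw [zero_div, sub_zero] at h
  exact h.trans (le_ciSup (f := fun σ : G.SysStrategy => strategyValue R γ s σ)
    ⟨v s, by rintro _ ⟨σ, rfl⟩; exact strategyValue_le R hγ₀ hγ₁ hsys hopt σ s⟩ σ)

end Optimal

end RabinGame

/-! ### The perturbed strategy -/

theorem theorem2 {S A : Type*} [Fintype S] [Fintype A] (G : RabinGame S A)
    (R : S → A → S → ℝ≥0) (γ : ℝ) (hγ₀ : 0 < γ) (hγ₁ : γ < 1)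
    (σ : G.SysStrategy) (hσ_memoryless : σ.IsMemoryless)
    (hσ_winning : RabinGame.AlmostSureWinning σ)
    (hσ_optimal : ∀ s : G.sys, (σ.allowed s σ.init ∩ G.optimalActions R γ s).Nonempty) :
    ∀ ε : ℝ, 0 < ε → ∃ σ' : G.SysStrategy,
      σ'.IsMemoryless ∧
      (∀ s : G.sys, σ'.allowed s σ'.init = σ.allowed s σ.init) ∧
      RabinGame.AlmostSureWinning σ' ∧
      RabinGame.EpsOptimal R γ ε σ' := by
  classical
  intro ε hε
  obtain ⟨v, hsys, henv, hopt⟩ := RabinGame.exists_shapley_solution G R hγ₀ hγ₁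
  have hv := RabinGame.optimalValue_eq R hγ₀ hγ₁ hsys henv hopt
  choose b hb hbopt using hσ_optimal
  -- Since the optimal value is `v`, `b s` maximizes the advantage; the maximum is zero because no
  -- available action exceeds zero and some action attains it.
  have hb0 : ∀ s : G.sys, G.advantage R γ v s (b s) = 0 := by
    intro s
    obtain ⟨a, ha, ha0⟩ := hopt s
    have h1 : G.stepValue R γ v s a ≤ G.stepValue R γ v s (b s) := by
      have := (hbopt s).2 a ha
      unfold RabinGame.actionValue at this
      rwa [hv] at this
    have h2 := hsys s s.2 (b s) (hbopt s).1
    simp only [RabinGame.advantage] at *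
    linarith
  obtain ⟨K, hK⟩ := RabinGame.exists_abs_le fun p : S × A => G.advantage R γ v p.1 p.2
  obtain ⟨d, hd₀, hd₁, hd⟩ : ∃ d : ℝ, 0 < d ∧ d < 1 ∧ d * |K| / (1 - γ) ≤ ε := by
    have hγ : 0 < 1 - γ := by linarith
    have hK1 : 0 < |K| + 1 := by positivity
    have hq : 0 < ε * (1 - γ) / (|K| + 1) := by positivity
    -- The bound `1 / 2` keeps `d < 1`, and the `+ 1` avoids division by zero when `K = 0`.
    refine ⟨min (1 / 2) (ε * (1 - γ) / (|K| + 1)), lt_min (by norm_num) hq,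
      (min_le_left _ _).trans_lt (by norm_num), ?_⟩
    rw [div_le_iff₀ hγ]
    calc _ ≤ ε * (1 - γ) / (|K| + 1) * (|K| + 1) := by
          gcongr
          · exact min_le_right _ _
          · linarith
      _ = ε * (1 - γ) := div_mul_cancel₀ _ hK1.ne'
  set σ' : G.SysStrategy :=
    { Mem := Unit
      countable_mem := inferInstance
      init := ()
      act := fun s _ => (PMF.pure (b s)).mix (σ.act s σ.init) d hd₀ hd₁
      update := fun _ _ => ()
      act_avail := fun s _ => by
        rw [PMF.support_mix, PMF.support_pure]
        exact Set.union_subset (by simpa using (hbopt s).1) (σ.act_avail _ _) } with hσ'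
  have hmem : σ'.IsMemoryless := ⟨(), fun _ => rfl⟩
  have hallowed : ∀ s : G.sys, σ'.allowed s σ'.init = σ.allowed s σ.init := by
    intro s
    have hbs := hb s
    rw [RabinGame.allowed_eq_support] at hbs
    rw [RabinGame.allowed_eq_support, RabinGame.allowed_eq_support]
    change ((PMF.pure (b s)).mix (σ.act s σ.init) d hd₀ hd₁).support = _
    rw [PMF.support_mix, PMF.support_pure, Set.union_eq_right, Set.singleton_subset_iff]
    exact hbs
  refine ⟨σ', hmem, hallowed, hσ_winning.of_allowed_eq hσ_memoryless hmem hallowed, fun s => ?_⟩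
  rw [hv]
  have h := RabinGame.le_strategyValue R hγ₀ hγ₁ henv (η := d * |K|) (by positivity) σ'
    (fun s m => by
      change _ ≤ ∑ a, ((PMF.pure (b s)).mix (σ.act s σ.init) d hd₀ hd₁ a).toReal * _
      simp only [PMF.mix_toReal, add_mul, Finset.sum_add_distrib, mul_assoc, ← Finset.mul_sum]
      rw [RabinGame.sum_pure_toReal_mul, hb0, mul_zero, zero_add, ← mul_neg]
      refine mul_le_mul_of_nonneg_left ?_ hd₀.le
      -- The pure part has advantage zero; shifting by `|K|` shows that the `σ` part averages at
      -- least `-|K|`.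
      have hnn := RabinGame.sum_toReal_mul_nonneg (p := σ.act s σ.init)
        (f := fun a => G.advantage R γ v s a + |K|) (fun a _ => by
          linarith [neg_abs_le (G.advantage R γ v s a), hK (s, a), le_abs_self K])
      simp only [mul_add, Finset.sum_add_distrib, ← Finset.sum_mul, PMF.sum_toReal, one_mul] at hnn
      linarith) s
  linarith
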